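/- Let $n\ge 3$, $m\ge 2$, and let $g_{ij}=\delta_{ij}\varepsilon_i$ ($\varepsilon_i=\pm1$) be a pseudo-Euclidean metric on $\mathbb R^n$. Let $\xi=\sum_{i=1}^n a_ix_i$ with $a_i\in\mathbb R$ and $\sum_i\varepsilon_i a_i^2\neq 0$ (a non-null direction), and let $(F^m,g_F)$ be a (non-empty) smooth semi-Riemannian manifold of dimension $m$ which is Ricci-flat. Put $$\beta=\frac{\sqrt{m(n-1)(m+n-2)}}{n-1},\qquad \alpha_\pm=\frac{m\pm\beta}{n-2}.$$ (1) Let $J\subseteq\mathbb R$ be an open interval (possibly unbounded), and let $\varphi,f:J\to\mathbb R$ be smooth and non-constant, with $f>0$ and $\varphi$ nowhere zero. Then the warped product $M=\bigl(\{x\in\mathbb R^n:\xi(x)\in J\},\ \varphi(\xi)^{-2}g\bigr)\times_{f(\xi)}F$, i.e. the product manifold with the metric $\varphi(\xi)^{-2}g+f(\xi)^2g_F$, is Ricci-flat if and only if there are a choice of sign (the upper signs throughout, or the lower signs throughout) and real constants $k\ne0$, $k_1\neq0$, $k_2$ such that for all $\xi\in J$ $$\mp\beta(k_1\xi+k_2)>0,\qquad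 f(\xi)=\bigl[\mp\beta(k_1\xi+k_2)\bigr]^{\mp 1/\beta},\qquad \varphi(\xi)=k\bigl[\mp\beta(k_1\xi+k_2)\bigr]^{\mp\alpha_\pm/\beta}.$$ (Here $k$ has the sign of $\varphi$.) (2) For all constants $k>0$, $k_1>0$, $k_2\in\mathbb R$, the pair $(\varphi,f)$ given by these formulas with the upper signs consists of smooth, non-constant, positive functions on $\{\xi<-k_2/k_1\}$ and gives a Ricci-flat warped product over the half space $\{\sum_i a_ix_i<-k_2/k_1\}$; the pair with the lower signs does so on $\{\xi>-k_2/k_1\}$, over the half space $\{\sum_i a_ix_i>-k_2/k_1\}$. -/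

import Mathlib

open scoped Manifold ContDiff

set_option maxSynthPendingDepth 3

noncomputable section

namespace SemiRiem

/-! ### Curvature of a metric on (an open part of) a finite-dimensional vector space

`G y` is the matrix-free form of the coordinate components `g_ij (y)` of a metric. -/

section Local

variable {E : Type*} [NormedAddCommGroup E] [NormedSpace ℝ E]

/-- Christoffel symbols of the first kind,
`(u, v, w) ↦ ½ (∂_u G (v, w) + ∂_v G (u, w) - ∂_w G (u, v))` at the point `y`. -/
def christoffelFirst (G : E → E →L[ℝ] E →L[ℝ] ℝ) (y : E) : E →L[ℝ] E →L[ℝ] E →L[ℝ] ℝ :=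
  (1 / 2 : ℝ) • (fderiv ℝ G y + (fderiv ℝ G y).flip -
    ((ContinuousLinearMap.flipₗᵢ ℝ E E ℝ).toContinuousLinearEquiv :
      (E →L[ℝ] E →L[ℝ] ℝ) →L[ℝ] (E →L[ℝ] E →L[ℝ] ℝ)).comp (fderiv ℝ G y).flip)

theorem christoffelFirst_apply (G : E → E →L[ℝ] E →L[ℝ] ℝ) (y u v w : E) :
    christoffelFirst G y u v w =
      (1 / 2) * (fderiv ℝ G y u v w + fderiv ℝ G y v u w - fderiv ℝ G y w u v) := by
  simp [christoffelFirst]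

/-- Christoffel symbols of the second kind (the Levi-Civita connection in coordinates): the vector
`christoffel G y u v` is obtained from the covector `christoffelFirst G y u v` by raising the index,
i.e. by applying the inverse of `G y : E → E*`. -/
def christoffel (G : E → E →L[ℝ] E →L[ℝ] ℝ) (y : E) : E →L[ℝ] E →L[ℝ] E :=
  (ContinuousLinearMap.compL ℝ E (E →L[ℝ] ℝ) E (G y).inverse).comp (christoffelFirst G y)

theorem christoffel_apply (G : E → E →L[ℝ] E →L[ℝ] ℝ) (y u v : E) :
    christoffel G y u v = (G y).inverse (christoffelFirst G y u v) := rfl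

/-- For fixed `v, w`, the endomorphism `u ↦ R(u, v) w` where
`R(u, v) w = ∂_u Γ (v, w) - ∂_v Γ (u, w) + Γ (u, Γ (v, w)) - Γ (v, Γ (u, w))`. -/
def curvatureEnd (G : E → E →L[ℝ] E →L[ℝ] ℝ) (y v w : E) : E →L[ℝ] E :=
  ((fderiv ℝ (christoffel G) y).flip v).flip w - (fderiv ℝ (christoffel G) y v).flip w +
    (christoffel G y).flip (christoffel G y v w) -
    (christoffel G y v).comp ((christoffel G y).flip w)

theorem curvatureEnd_apply (G : E → E →L[ℝ] E →L[ℝ] ℝ) (y u v w : E) :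
    curvatureEnd G y v w u =
      fderiv ℝ (christoffel G) y u v w - fderiv ℝ (christoffel G) y v u w +
        christoffel G y u (christoffel G y v w) - christoffel G y v (christoffel G y u w) := by
  simp [curvatureEnd]

/-- The Ricci tensor in coordinates, `Ric (v, w) = tr (u ↦ R(u, v) w)`. -/
def localRicci (G : E → E →L[ℝ] E →L[ℝ] ℝ) (y v w : E) : ℝ :=
  LinearMap.trace ℝ E (curvatureEnd G y v w : E →ₗ[ℝ] E)

end Local

/-! ### Metric tensors on manifolds -/

section Manifold

variable {E : Type*} [NormedAddCommGroup E] [NormedSpace ℝ E]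
  {H : Type*} [TopologicalSpace H] {I : ModelWithCorners ℝ E H}
  {M : Type*} [TopologicalSpace M] [ChartedSpace H M]
  {E' : Type*} [NormedAddCommGroup E'] [NormedSpace ℝ E']
  {H' : Type*} [TopologicalSpace H'] {I' : ModelWithCorners ℝ E' H'}
  {M' : Type*} [TopologicalSpace M'] [ChartedSpace H' M']

variable (I M) in
/-- A field of bilinear forms on the tangent spaces of `M`. -/
abbrev BilinField : Type _ :=
  ∀ p : M, TangentSpace I p →L[ℝ] TangentSpace I p →L[ℝ] ℝ

/-- The pullback `h^* g`, `(h^* g)_p (u, v) = g_{h p} (dh_p u, dh_p v)`. -/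
def pullback (h : M → M') (g : BilinField I' M') : BilinField I M := fun p =>
  ContinuousLinearMap.bilinearComp (E := E') (F := E') (E' := E) (F' := E) (G := ℝ)
    (g (h p)) (mfderiv I I' h p) (mfderiv I I' h p)

theorem pullback_apply (h : M → M') (g : BilinField I' M') (p : M) (u v : TangentSpace I p) :
    (pullback h g : BilinField I M) p u v = g (h p) (mfderiv I I' h p u) (mfderiv I I' h p v) := rfl

/-- The expression of `g` in the preferred chart at `p`: the pullback of `g` to the model space
under the inverse of that chart (meaningful on the target of the chart). -/
def inChart (g : BilinField I M) (p : M) : E → E →L[ℝ] E →L[ℝ] ℝ :=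
  (pullback (extChartAt I p).symm g : BilinField 𝓘(ℝ, E) E)

/-- `g` is a smooth semi-Riemannian metric: symmetric, nondegenerate, and smooth in charts. -/
structure IsSemiRiemannianMetric (g : BilinField I M) : Prop where
  symm : ∀ (p : M) (u v : TangentSpace I p), g p u v = g p v u
  nondegenerate : ∀ (p : M) (u : TangentSpace I p), (∀ v : TangentSpace I p, g p u v = 0) → u = 0
  smooth : ∀ p : M, ContDiffOn ℝ ∞ (inChart g p) (extChartAt I p).target

/-- The Ricci tensor at `p`, computed in the preferred chart at `p` (through which Mathlib
identifies the tangent space at `p` with the model space `E`). -/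
def ricci (g : BilinField I M) (p : M) (u v : TangentSpace I p) : ℝ :=
  localRicci (inChart g p) (extChartAt I p p) u v

/-- The Ricci tensor of `g` vanishes at every point of `U`. For an open set `U` this says that `U`
with the metric `g` restricted to it is a Ricci-flat manifold. -/
def IsRicciFlatOn (g : BilinField I M) (U : Set M) : Prop :=
  ∀ p ∈ U, ∀ u v : TangentSpace I p, ricci g p u v = 0

/-- The warped product tensor `π^* g_B + (f ∘ π)^2 σ^* g_F` on `B × F`, where `π` and `σ` are the
projections to the base and to the fiber. -/
def warped (gB : BilinField I M) (f : M → ℝ) (gF : BilinField I' M') :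
    BilinField (I.prod I') (M × M') := fun p =>
  (pullback Prod.fst gB : BilinField (I.prod I') (M × M')) p +
    (f p.1) ^ 2 • (pullback Prod.snd gF : BilinField (I.prod I') (M × M')) p

theorem warped_apply (gB : BilinField I M) (f : M → ℝ) (gF : BilinField I' M') (p : M × M')
    (u v : TangentSpace I p.1 × TangentSpace I' p.2) :
    warped gB f gF p u v = gB p.1 u.1 v.1 + f p.1 ^ 2 * gF p.2 u.2 v.2 := by
  have h1 : mfderiv (I.prod I') I (Prod.fst : M × M' → M) p = ContinuousLinearMap.fst ℝ E E' :=
    mfderiv_fst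
  have h2 : mfderiv (I.prod I') I' (Prod.snd : M × M' → M') p = ContinuousLinearMap.snd ℝ E E' :=
    mfderiv_snd
  change gB p.1 (mfderiv (I.prod I') I (Prod.fst : M × M' → M) p u)
      (mfderiv (I.prod I') I (Prod.fst : M × M' → M) p v) +
    f p.1 ^ 2 * gF p.2 (mfderiv (I.prod I') I' (Prod.snd : M × M' → M') p u)
      (mfderiv (I.prod I') I' (Prod.snd : M × M' → M') p v) = _
  rw [h1, h2]
  rfl

end Manifold

/-! ### The base: a conformal change of the pseudo-Euclidean space -/

/-- The bilinear form `(u, v) ↦ ∑ ε_i u_i v_i` on `ℝ^n`. -/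
def pseudoForm {n : ℕ} (ε : Fin n → ℝ) :
    EuclideanSpace ℝ (Fin n) →L[ℝ] EuclideanSpace ℝ (Fin n) →L[ℝ] ℝ :=
  ∑ i, ε i • (EuclideanSpace.proj i : EuclideanSpace ℝ (Fin n) →L[ℝ] ℝ).smulRight
    (EuclideanSpace.proj i : EuclideanSpace ℝ (Fin n) →L[ℝ] ℝ)

theorem pseudoForm_apply {n : ℕ} (ε : Fin n → ℝ) (u v : EuclideanSpace ℝ (Fin n)) :
    pseudoForm ε u v = ∑ i, ε i * (u i * v i) := by
  simp [pseudoForm]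

/-- The pseudo-Euclidean metric `g_ij = δ_ij ε_i` on `ℝ^n`. -/
def pseudoEuclidean {n : ℕ} (ε : Fin n → ℝ) : BilinField (𝓡 n) (EuclideanSpace ℝ (Fin n)) :=
  fun _ => pseudoForm ε

/-- The linear function `ξ = ∑ α_i x_i`. -/
def xi {n : ℕ} (a : Fin n → ℝ) (x : EuclideanSpace ℝ (Fin n)) : ℝ := ∑ i, a i * x i

/-- The conformal metric `φ(ξ)⁻² g`, with `g` the pseudo-Euclidean metric. -/
def baseMetric {n : ℕ} (ε a : Fin n → ℝ) (φ : ℝ → ℝ) :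
    BilinField (𝓡 n) (EuclideanSpace ℝ (Fin n)) :=
  fun x => (1 / (φ (xi a x)) ^ 2) • pseudoEuclidean ε x

/-- The metric `φ(ξ)⁻² g + f(ξ)² g_F` of the warped product with base `(ℝ^n, φ(ξ)⁻² g)`, fiber `F`
and warping function `f(ξ)`. -/
def warpedMetric {n m : ℕ} {F : Type*} [TopologicalSpace F]
    [ChartedSpace (EuclideanSpace ℝ (Fin m)) F] (ε a : Fin n → ℝ) (φ f : ℝ → ℝ)
    (gF : BilinField (𝓡 m) F) :
    BilinField ((𝓡 n).prod (𝓡 m)) (EuclideanSpace ℝ (Fin n) × F) :=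
  warped (baseMetric ε a φ) (fun x => f (xi a x)) gF

/-- Non-constant smooth functions `φ` (nowhere zero) and `f` (positive) on the open interval `J`,
which may be unbounded. -/
structure IsProfile (J : Set ℝ) (φ f : ℝ → ℝ) : Prop where
  isOpen : IsOpen J
  ordConnected : J.OrdConnected
  smooth_φ : ContDiffOn ℝ ∞ φ J
  smooth_f : ContDiffOn ℝ ∞ f J
  φ_ne_zero : ∀ t ∈ J, φ t ≠ 0
  f_pos : ∀ t ∈ J, 0 < f t
  φ_nonconst : ¬ ∃ c, ∀ t ∈ J, φ t = c
  f_nonconst : ¬ ∃ c, ∀ t ∈ J, f t = c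

/-! ### The explicit functions

The sign `s = 1` is the upper choice of the signs `±`, `∓` and `s = -1` is the lower choice. -/

/-- `β = √(m (n - 1) (m + n - 2)) / (n - 1)`. -/
def betaC (n m : ℕ) : ℝ :=
  Real.sqrt ((m : ℝ) * ((n : ℝ) - 1) * ((m : ℝ) + (n : ℝ) - 2)) / ((n : ℝ) - 1)

/-- `α = (m ± β) / (n - 2)`. -/
def alphaC (n m : ℕ) (s : ℝ) : ℝ := ((m : ℝ) + s * betaC n m) / ((n : ℝ) - 2)

/-- `∓ β (k₁ ξ + k₂)`. -/
def solBase (n m : ℕ) (s k₁ k₂ t : ℝ) : ℝ := -s * betaC n m * (k₁ * t + k₂)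

/-- `f_∓ (ξ) = [∓ β (k₁ ξ + k₂)] ^ (∓ 1 / β)`. -/
def solF (n m : ℕ) (s k₁ k₂ t : ℝ) : ℝ := solBase n m s k₁ k₂ t ^ (-s * (1 / betaC n m))

/-- `φ_∓ (ξ) = k [∓ β (k₁ ξ + k₂)] ^ (∓ α / β)`. -/
def solPhi (n m : ℕ) (s k k₁ k₂ t : ℝ) : ℝ :=
  k * solBase n m s k₁ k₂ t ^ (-s * (alphaC n m s / betaC n m))

end SemiRiem

end

open SemiRiem

open scoped Manifold ContDiff Topology
open Filter

namespace SemiRiem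

/-! ### Coordinate Christoffel symbols and Ricci tensor of a metric on a vector space. -/

section Abstract

variable {E : Type*} [NormedAddCommGroup E] [NormedSpace ℝ E]

/-! In a chart of `F`, the warped product is an explicit metric on a product of vector spaces. Write
`p = φ'/φ`, `q = f'/f`, and let `d` be the vector `g`-dual to `ξ`. Computing the Levi-Civita
connection and tracing the curvature (`localRicci_warpedLocal`) shows that the Ricci tensor is a
combination of `ξ ⊗ ξ`, `g` and `g_F`, with coefficients depending on `ξ` only, plus the Ricci
tensor of `F`. The last is zero, and since `ξ(d) = ∑ ε_i a_i² ≠ 0`, suitable test vectors separate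
the three tensors. Ricci-flatness thus becomes three scalar ODEs (`isRicciFlatOn_warpedMetric_iff`).

The coefficients of `g` and `g_F` give `p' = p((n-2)p - mq)` and `q' = q((n-2)p - mq)`. These are
linear equations with the same coefficient, so `p` and `q` are constant multiples of one function
without zeros. As `f` is not constant, `q` vanishes nowhere and `p = αq` with `α` constant. The
coefficient of `ξ ⊗ ξ` then reduces to a quadratic equation for `α`, whose roots are `α_±`. Since
`(n-2)α_± - m = ±β`, what remains is `q' = ±β q²`: hence `1/q` is affine, `f` is a power of an
affine function, and `φ = k f^α` (`exists_eq_sol_of_ricciFlatODE`). The converse is substitution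
(`ricciFlatODE_of_eq_sol`), and part (2) is an instance of part (1). -/

theorem isInvertible_of_separatingLeft [FiniteDimensional ℝ E] (L : E →L[ℝ] E →L[ℝ] ℝ)
    (h : ∀ u, (∀ v, L u v = 0) → u = 0) : L.IsInvertible := by
  have hfr : Module.finrank ℝ E = Module.finrank ℝ (E →L[ℝ] ℝ) := by
    rw [← (LinearMap.toContinuousLinearMap (𝕜 := ℝ) (E := E) (F' := ℝ)).finrank_eq]
    exact (Subspace.dual_finrank_eq (K := ℝ) (V := E)).symm
  have hinj : Function.Injective (L : E →ₗ[ℝ] E →L[ℝ] ℝ) := by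
    rw [← LinearMap.ker_eq_bot, LinearMap.ker_eq_bot']
    intro u hu
    exact h u fun v => by
      have := congrArg (fun T : E →L[ℝ] ℝ => T v) hu
      simpa using this
  exact ⟨(LinearEquiv.ofInjectiveOfFinrankEq (L : E →ₗ[ℝ] E →L[ℝ] ℝ) hinj hfr).toContinuousLinearEquiv,
    by ext; rfl⟩

theorem ContinuousLinearMap.IsInvertible.inverse_apply_self {F : Type*} [NormedAddCommGroup F]
    [NormedSpace ℝ F] {L : E →L[ℝ] F} (h : L.IsInvertible) (u : E) : L.inverse (L u) = u := by
  obtain ⟨e, rfl⟩ := h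
  simp

theorem christoffel_congr {G G' : E → E →L[ℝ] E →L[ℝ] ℝ} {z : E} (h : G =ᶠ[𝓝 z] G') :
    christoffel G =ᶠ[𝓝 z] christoffel G' := by
  filter_upwards [h, h.fderiv (𝕜 := ℝ)] with y h1 h2
  simp only [christoffel, christoffelFirst, h1, h2]

/-- The Ricci tensor at a point depends only on the germ of the metric. This allows a chart
expression, controlled only on the chart target, to be replaced by an explicit formula. -/
theorem localRicci_congr {G G' : E → E →L[ℝ] E →L[ℝ] ℝ} {z : E} (h : G =ᶠ[𝓝 z] G') :
    localRicci G z = localRicci G' z := by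
  have h1 := christoffel_congr h
  ext v w
  simp only [localRicci, curvatureEnd, h1.fderiv_eq (𝕜 := ℝ), h1.eq_of_nhds]

theorem differentiableAt_christoffel [CompleteSpace E] {G : E → E →L[ℝ] E →L[ℝ] ℝ} {z : E}
    (h : ContDiffAt ℝ 2 G z) (hz : (G z).IsInvertible) :
    DifferentiableAt ℝ (christoffel G) z := by
  have hd : DifferentiableAt ℝ (fderiv ℝ G) z :=
    (h.fderiv_right (m := 1) (by norm_num)).differentiableAt (by norm_num)
  have hi : DifferentiableAt ℝ (fun y => (G y).inverse) z := by
    obtain ⟨e, he⟩ := hz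
    have h1 := contDiffAt_map_inverse (𝕜 := ℝ) (n := 1) e
    rw [he] at h1
    exact (h1.differentiableAt (by norm_num)).comp z (h.differentiableAt (by norm_num))
  have hf : DifferentiableAt ℝ (fun y => (fderiv ℝ G y).flip) z :=
    (ContinuousLinearMap.flipₗᵢ ℝ E E (E →L[ℝ] ℝ)).toContinuousLinearEquiv.differentiableAt.comp z hd
  have hcf : DifferentiableAt ℝ (christoffelFirst G) z := by
    have h1 := ((hd.add hf).sub ((differentiableAt_const
      ((ContinuousLinearMap.flipₗᵢ ℝ E E ℝ).toContinuousLinearEquiv :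
        (E →L[ℝ] E →L[ℝ] ℝ) →L[ℝ] (E →L[ℝ] E →L[ℝ] ℝ))).clm_comp hf)).const_smul (1 / 2 : ℝ)
    exact h1
  unfold christoffel
  exact ((ContinuousLinearMap.compL ℝ E (E →L[ℝ] ℝ) E).differentiableAt.comp z hi).clm_comp hcf

theorem fderiv_apply_apply {F F' F'' : Type*} [NormedAddCommGroup F] [NormedSpace ℝ F]
    [NormedAddCommGroup F'] [NormedSpace ℝ F'] [NormedAddCommGroup F''] [NormedSpace ℝ F'']
    {T : E → F →L[ℝ] F' →L[ℝ] F''} {z : E} (h : DifferentiableAt ℝ T z) (u : E) (v : F) (w : F') :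
    fderiv ℝ T z u v w = fderiv ℝ (fun y => T y v w) z u := by
  have h1 : HasFDerivAt (fun y => T y v w)
      ((ContinuousLinearMap.apply ℝ F'' w).comp
        ((ContinuousLinearMap.apply ℝ (F' →L[ℝ] F'') v).comp (fderiv ℝ T z))) z :=
    (ContinuousLinearMap.apply ℝ F'' w).hasFDerivAt.comp z
      ((ContinuousLinearMap.apply ℝ (F' →L[ℝ] F'') v).hasFDerivAt.comp z h.hasFDerivAt)
  rw [h1.fderiv]
  rfl

/-- Raising an index is inverse to lowering it, so a guess for the connection can be verified
against the Koszul formula without computing any inverse metric. -/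
theorem christoffel_eq_of_isInvertible {G : E → E →L[ℝ] E →L[ℝ] ℝ} {z : E}
    (hz : (G z).IsInvertible) {u v x : E} (h : ∀ w, G z x w = christoffelFirst G z u v w) :
    christoffel G z u v = x := by
  rw [christoffel_apply, ← hz.inverse_apply_self x]
  congr 1
  ext w
  exact (h w).symm

theorem apply_christoffel {G : E → E →L[ℝ] E →L[ℝ] ℝ} {z : E}
    (hz : (G z).IsInvertible) (u v w : E) :
    G z (christoffel G z u v) w = christoffelFirst G z u v w := by
  obtain ⟨e, he⟩ := hz
  rw [christoffel_apply, ← he, ContinuousLinearMap.inverse_equiv]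
  simp

theorem fderiv_bilin_symm {G : E → E →L[ℝ] E →L[ℝ] ℝ} {z : E} (h : DifferentiableAt ℝ G z)
    (hs : ∀ y u v, G y u v = G y v u) (u v w : E) :
    fderiv ℝ G z u v w = fderiv ℝ G z u w v := by
  rw [fderiv_apply_apply h, fderiv_apply_apply h]
  simp only [hs _ v w]

theorem christoffel_symm {G : E → E →L[ℝ] E →L[ℝ] ℝ} {z : E} (h : DifferentiableAt ℝ G z)
    (hs : ∀ y u v, G y u v = G y v u) (u v : E) : christoffel G z u v = christoffel G z v u := by
  rw [christoffel_apply, christoffel_apply]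
  congr 1
  ext w
  rw [christoffelFirst_apply, christoffelFirst_apply, fderiv_bilin_symm h hs w u v]
  ring

/-- Split `T` along the two projections and use `tr(AB) = tr(BA)` for maps between different spaces:
only the diagonal blocks survive. -/
theorem trace_prod_eq {F : Type*} [NormedAddCommGroup F] [NormedSpace ℝ F]
    [FiniteDimensional ℝ E] [FiniteDimensional ℝ F] (T : E × F →ₗ[ℝ] E × F) :
    LinearMap.trace ℝ (E × F) T =
      LinearMap.trace ℝ E (LinearMap.fst ℝ E F ∘ₗ T ∘ₗ LinearMap.inl ℝ E F) +
      LinearMap.trace ℝ F (LinearMap.snd ℝ E F ∘ₗ T ∘ₗ LinearMap.inr ℝ E F) := by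
  have h : T = (T ∘ₗ LinearMap.inl ℝ E F) ∘ₗ LinearMap.fst ℝ E F +
      (T ∘ₗ LinearMap.inr ℝ E F) ∘ₗ LinearMap.snd ℝ E F := by
    ext x <;> simp [← Prod.zero_eq_mk]
  conv_lhs => rw [h, map_add, LinearMap.trace_comp_comm' (LinearMap.fst ℝ E F),
    LinearMap.trace_comp_comm' (LinearMap.snd ℝ E F)]

end Abstract

end SemiRiem

namespace SemiRiem

/-! ### Levi-Civita connection of the warped metric in coordinates. -/

section WarpedLocal

variable {E : Type*} [NormedAddCommGroup E] [NormedSpace ℝ E]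
  {F : Type*} [NormedAddCommGroup F] [NormedSpace ℝ F]

/-- The metric `φ(λ)⁻² g + f(λ)² B` on a product of vector spaces, with `g` constant and `λ` a linear
form on the first factor. -/
noncomputable def warpedLocal (g : E →L[ℝ] E →L[ℝ] ℝ) (l : E →L[ℝ] ℝ) (φ f : ℝ → ℝ)
    (B : F → F →L[ℝ] F →L[ℝ] ℝ) (z : E × F) : E × F →L[ℝ] E × F →L[ℝ] ℝ :=
  (1 / φ (l z.1) ^ 2) • g.bilinearComp (ContinuousLinearMap.fst ℝ E F)
      (ContinuousLinearMap.fst ℝ E F) +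
    f (l z.1) ^ 2 • (B z.2).bilinearComp (ContinuousLinearMap.snd ℝ E F)
      (ContinuousLinearMap.snd ℝ E F)

theorem warpedLocal_apply (g : E →L[ℝ] E →L[ℝ] ℝ) (l : E →L[ℝ] ℝ) (φ f : ℝ → ℝ)
    (B : F → F →L[ℝ] F →L[ℝ] ℝ) (z v w : E × F) :
    warpedLocal g l φ f B z v w =
      1 / φ (l z.1) ^ 2 * g v.1 w.1 + f (l z.1) ^ 2 * B z.2 v.2 w.2 := by
  simp [warpedLocal]

variable {g : E →L[ℝ] E →L[ℝ] ℝ} {l : E →L[ℝ] ℝ} {φ f : ℝ → ℝ}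
  {B : F → F →L[ℝ] F →L[ℝ] ℝ} {z : E × F}

theorem contDiffAt_warpedLocal {k : WithTop ℕ∞} (hφ : ContDiffAt ℝ k φ (l z.1))
    (hf : ContDiffAt ℝ k f (l z.1)) (hφ0 : φ (l z.1) ≠ 0) (hB : ContDiffAt ℝ k B z.2) :
    ContDiffAt ℝ k (warpedLocal g l φ f B) z := by
  have hl : ContDiffAt ℝ k (fun z : E × F => l z.1) z := l.contDiff.contDiffAt.comp z contDiffAt_fst
  have h1 : ContDiffAt ℝ k (fun z : E × F => 1 / φ (l z.1) ^ 2) z :=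
    contDiffAt_const.div ((hφ.comp z hl).pow 2) (pow_ne_zero 2 hφ0)
  have h2 : ContDiffAt ℝ k (fun z : E × F => f (l z.1) ^ 2) z := (hf.comp z hl).pow 2
  have h3 : ContDiffAt ℝ k (fun z : E × F => (B z.2).bilinearComp (ContinuousLinearMap.snd ℝ E F)
      (ContinuousLinearMap.snd ℝ E F)) z := by
    have h4 : ContDiffAt ℝ k (fun z : E × F => B z.2) z := hB.comp z contDiffAt_snd
    have h5 := (ContinuousLinearMap.flipₗᵢ ℝ (E × F) F ℝ).toContinuousLinearEquiv.contDiff.contDiffAt.comp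
      z (h4.clm_comp (contDiffAt_const (c := ContinuousLinearMap.snd ℝ E F)))
    have h6 := (ContinuousLinearMap.flipₗᵢ ℝ (E × F) (E × F) ℝ).toContinuousLinearEquiv.contDiff.contDiffAt.comp
      z (h5.clm_comp (contDiffAt_const (c := ContinuousLinearMap.snd ℝ E F)))
    exact h6
  exact (h1.smul contDiffAt_const).add (h2.smul h3)

theorem isInvertible_warpedLocal [FiniteDimensional ℝ E] [FiniteDimensional ℝ F]
    (hφ0 : φ (l z.1) ≠ 0) (hf0 : f (l z.1) ≠ 0)
    (hg : ∀ u, (∀ v, g u v = 0) → u = 0) (hB : ∀ u, (∀ v, B z.2 u v = 0) → u = 0) :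
    (warpedLocal g l φ f B z).IsInvertible := by
  refine isInvertible_of_separatingLeft _ fun u hu => ?_
  ext1
  · refine hg _ fun v => ?_
    have := hu (v, 0)
    simpa [warpedLocal_apply, hφ0] using this
  · refine hB _ fun v => ?_
    have := hu (0, v)
    simpa [warpedLocal_apply, hf0] using this

theorem fderiv_warpedLocal {φ' f' : ℝ} (hφ : HasDerivAt φ φ' (l z.1))
    (hf : HasDerivAt f f' (l z.1)) (hφ0 : φ (l z.1) ≠ 0) (hB : DifferentiableAt ℝ B z.2)
    (hG : DifferentiableAt ℝ (warpedLocal g l φ f B) z) (u v w : E × F) :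
    fderiv ℝ (warpedLocal g l φ f B) z u v w =
      -2 * φ' / φ (l z.1) ^ 3 * l u.1 * g v.1 w.1 + 2 * f (l z.1) * f' * l u.1 * B z.2 v.2 w.2 +
        f (l z.1) ^ 2 * fderiv ℝ B z.2 u.2 v.2 w.2 := by
  rw [fderiv_apply_apply hG, fderiv_apply_apply hB]
  simp only [warpedLocal_apply]
  have hl : HasFDerivAt (fun z : E × F => l z.1) (l.comp (ContinuousLinearMap.fst ℝ E F)) z :=
    l.hasFDerivAt.comp z hasFDerivAt_fst
  have h1 := (hφ.comp_hasFDerivAt z hl)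
  have h2 := (hf.comp_hasFDerivAt z hl)
  have h3 : HasFDerivAt (fun z : E × F => B z.2 v.2 w.2)
      ((fderiv ℝ (fun y => B y v.2 w.2) z.2).comp (ContinuousLinearMap.snd ℝ E F)) z :=
    HasFDerivAt.comp z ((hB.clm_apply (differentiableAt_const v.2)).clm_apply
      (differentiableAt_const w.2)).hasFDerivAt hasFDerivAt_snd
  have h4 : HasFDerivAt (fun z : E × F => 1 / φ (l z.1) ^ 2)
      ((-2 * φ' / φ (l z.1) ^ 3) • (l.comp (ContinuousLinearMap.fst ℝ E F))) z := by
    have h5 : HasDerivAt (fun t => 1 / φ t ^ 2) (-2 * φ' / φ (l z.1) ^ 3) (l z.1) := by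
      have := (hasDerivAt_const (l z.1) (1 : ℝ)).div (hφ.pow 2) (pow_ne_zero 2 hφ0)
      convert! this using 1
      simp
      field_simp
    exact HasDerivAt.comp_hasFDerivAt (h₂ := fun t => 1 / φ t ^ 2) z h5 hl
  have h6 := (h4.mul_const (g v.1 w.1)).add ((h2.pow 2).mul h3)
  have h7 := h6.fderiv
  simp only [Function.comp_def] at h7
  erw [h7]
  simp
  ring

/-- The Levi-Civita connection of `warpedLocal`, with `p = φ' / φ`, `q = f' / f`, `r = f f' φ²`,
`d` the vector dual to `λ` under `g`, and `Γ` the connection of `B`. -/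
noncomputable def warpedChristoffel (g : E →L[ℝ] E →L[ℝ] ℝ) (l : E →L[ℝ] ℝ) (d : E) (p q r : ℝ)
    (b : F →L[ℝ] F →L[ℝ] ℝ) (Γ : F →L[ℝ] F →L[ℝ] F) (v w : E × F) : E × F :=
  (-(p • (l v.1 • w.1 + l w.1 • v.1 - g v.1 w.1 • d)) - (r * b v.2 w.2) • d,
    Γ v.2 w.2 + q • (l v.1 • w.2 + l w.1 • v.2))

theorem christoffel_warpedLocal [FiniteDimensional ℝ E] [FiniteDimensional ℝ F] {d : E}
    {φ' f' : ℝ} (hφ : HasDerivAt φ φ' (l z.1)) (hf : HasDerivAt f f' (l z.1))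
    (hφ0 : φ (l z.1) ≠ 0) (hf0 : f (l z.1) ≠ 0) (hB : DifferentiableAt ℝ B z.2)
    (hG : DifferentiableAt ℝ (warpedLocal g l φ f B) z)
    (hg : ∀ u, (∀ v, g u v = 0) → u = 0) (hd : ∀ v, g d v = l v)
    (hBn : ∀ u, (∀ v, B z.2 u v = 0) → u = 0)
    (v w : E × F) :
    christoffel (warpedLocal g l φ f B) z v w =
      warpedChristoffel g l d (φ' / φ (l z.1)) (f' / f (l z.1)) (f (l z.1) * f' * φ (l z.1) ^ 2)
        (B z.2) (christoffel B z.2) v w := by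
  refine christoffel_eq_of_isInvertible (isInvertible_warpedLocal hφ0 hf0 hg hBn) fun x => ?_
  rw [christoffelFirst_apply, fderiv_warpedLocal hφ hf hφ0 hB hG, fderiv_warpedLocal hφ hf hφ0 hB hG,
    fderiv_warpedLocal hφ hf hφ0 hB hG, warpedLocal_apply]
  -- The part of the Koszul formula containing derivatives of `B` is exactly the lowered connection
  -- of the fiber.
  have h1 := apply_christoffel (isInvertible_of_separatingLeft _ hBn) v.2 w.2 x.2
  rw [christoffelFirst_apply] at h1
  simp only [warpedChristoffel, map_add, map_sub, map_neg, map_smul, add_apply,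
    neg_apply, sub_apply, smul_apply, smul_eq_mul, h1, hd]
  field_simp
  ring

end WarpedLocal

end SemiRiem

namespace SemiRiem

/-! ### Ricci tensor of the warped metric in coordinates. -/

section WarpedRicci

variable {E : Type*} [NormedAddCommGroup E] [NormedSpace ℝ E]
  {F : Type*} [NormedAddCommGroup F] [NormedSpace ℝ F]
  {g : E →L[ℝ] E →L[ℝ] ℝ} {l : E →L[ℝ] ℝ} {B : F → F →L[ℝ] F →L[ℝ] ℝ} {z : E × F}
  {Γ : F → F →L[ℝ] F →L[ℝ] F}

theorem fderiv_warpedChristoffel {p q r : ℝ → ℝ} {p' q' r' : ℝ} {d : E}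
    (hp : HasDerivAt p p' (l z.1)) (hq : HasDerivAt q q' (l z.1)) (hr : HasDerivAt r r' (l z.1))
    (hB : DifferentiableAt ℝ B z.2) (hΓ : DifferentiableAt ℝ Γ z.2) (u v w : E × F) :
    fderiv ℝ (fun y : E × F => warpedChristoffel g l d (p (l y.1)) (q (l y.1)) (r (l y.1))
        (B y.2) (Γ y.2) v w) z u =
      (-((p' * l u.1) • (l v.1 • w.1 + l w.1 • v.1 - g v.1 w.1 • d)) -
          (r (l z.1) * fderiv ℝ B z.2 u.2 v.2 w.2 + r' * l u.1 * B z.2 v.2 w.2) • d,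
        fderiv ℝ Γ z.2 u.2 v.2 w.2 + (q' * l u.1) • (l v.1 • w.2 + l w.1 • v.2)) := by
  have hl : HasFDerivAt (fun z : E × F => l z.1) (l.comp (ContinuousLinearMap.fst ℝ E F)) z :=
    l.hasFDerivAt.comp z hasFDerivAt_fst
  have h1 := hp.comp_hasFDerivAt z hl
  have h2 := hq.comp_hasFDerivAt z hl
  have h3 := hr.comp_hasFDerivAt z hl
  have h4 : HasFDerivAt (fun z : E × F => B z.2 v.2 w.2)
      ((fderiv ℝ (fun y => B y v.2 w.2) z.2).comp (ContinuousLinearMap.snd ℝ E F)) z :=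
    HasFDerivAt.comp z ((hB.clm_apply (differentiableAt_const v.2)).clm_apply
      (differentiableAt_const w.2)).hasFDerivAt hasFDerivAt_snd
  have h5 : HasFDerivAt (fun z : E × F => Γ z.2 v.2 w.2)
      ((fderiv ℝ (fun y => Γ y v.2 w.2) z.2).comp (ContinuousLinearMap.snd ℝ E F)) z :=
    HasFDerivAt.comp z ((hΓ.clm_apply (differentiableAt_const v.2)).clm_apply
      (differentiableAt_const w.2)).hasFDerivAt hasFDerivAt_snd
  have h6 := ((h1.smul_const (l v.1 • w.1 + l w.1 • v.1 - g v.1 w.1 • d)).neg.sub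
    ((h3.mul h4).smul_const d)).prodMk (h5.add (h2.smul_const (l v.1 • w.2 + l w.1 • v.2)))
  have h7 := congrArg (fun T => T u) h6.fderiv
  rw [fderiv_apply_apply hB, fderiv_apply_apply hΓ]
  refine h7.trans ?_
  ext1
  · simp
    module
  · simp

/-- The diagonal blocks of `u ↦ R(u, v) w` are sums of rank-one maps and multiples of the identity,
plus the fiber curvature in the second block. Their traces can be read off, and the identities
contribute the two dimensions. -/
theorem localRicci_of_christoffel_eq [FiniteDimensional ℝ E] [FiniteDimensional ℝ F]
    {G : E × F → E × F →L[ℝ] E × F →L[ℝ] ℝ} {p q r : ℝ → ℝ} {p' q' r' : ℝ} {d : E}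
    (hp : HasDerivAt p p' (l z.1)) (hq : HasDerivAt q q' (l z.1)) (hr : HasDerivAt r r' (l z.1))
    (hB : DifferentiableAt ℝ B z.2) (hΓ : DifferentiableAt ℝ (christoffel B) z.2)
    (hG : DifferentiableAt ℝ (christoffel G) z)
    (heq : ∀ᶠ y in 𝓝 z, ∀ v w, christoffel G y v w = warpedChristoffel g l d (p (l y.1))
      (q (l y.1)) (r (l y.1)) (B y.2) (christoffel B y.2) v w)
    (hgs : ∀ u v, g u v = g v u) (hd : ∀ v, g d v = l v) (hBs : ∀ y u v, B y u v = B y v u)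
    (v w : E × F) :
    localRicci G z v w =
      ((Module.finrank ℝ E - 2 : ℝ) * (p' + p (l z.1) ^ 2) -
        Module.finrank ℝ F * (q' + q (l z.1) ^ 2) -
        2 * Module.finrank ℝ F * p (l z.1) * q (l z.1)) * l v.1 * l w.1 +
      l d * (p' - (Module.finrank ℝ E - 2) * p (l z.1) ^ 2 +
        Module.finrank ℝ F * p (l z.1) * q (l z.1)) * g v.1 w.1 +
      l d * (-r' + Module.finrank ℝ E * p (l z.1) * r (l z.1) +
        (2 - Module.finrank ℝ F) * q (l z.1) * r (l z.1)) * B z.2 v.2 w.2 +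
      localRicci B z.2 v.2 w.2 := by
  have hC : ∀ v w, christoffel G z v w = warpedChristoffel g l d (p (l z.1))
      (q (l z.1)) (r (l z.1)) (B z.2) (christoffel B z.2) v w := heq.self_of_nhds
  have hdC : ∀ u v w, fderiv ℝ (christoffel G) z u v w =
      (-((p' * l u.1) • (l v.1 • w.1 + l w.1 • v.1 - g v.1 w.1 • d)) -
          (r (l z.1) * fderiv ℝ B z.2 u.2 v.2 w.2 + r' * l u.1 * B z.2 v.2 w.2) • d,
        fderiv ℝ (christoffel B) z.2 u.2 v.2 w.2 +
          (q' * l u.1) • (l v.1 • w.2 + l w.1 • v.2)) := by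
    intro u v w
    rw [fderiv_apply_apply hG, ← fderiv_warpedChristoffel hp hq hr hB hΓ]
    congr 1
    apply EventuallyEq.fderiv_eq
    filter_upwards [heq] with y hy using hy v w
  -- All derivatives are now recorded in `hdC`, so the values of `p`, `q`, `r` at the point may be
  -- treated as numbers.
  generalize p (l z.1) = p at *
  generalize q (l z.1) = q at *
  generalize r (l z.1) = r at *
  have hgd : ∀ v, g v d = l v := fun v => by rw [hgs, hd]
  set b := B z.2 v.2 w.2 with hb
  -- The base component of `∇_v w`, which enters the quadratic terms of the curvature.
  set X : E := -(p • (l v.1 • w.1 + l w.1 • v.1 - g v.1 w.1 • d)) - (r * b) • d with hX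
  have hlX : l X = -(p * (2 * l v.1 * l w.1 - g v.1 w.1 * l d)) - r * b * l d := by
    rw [hX]
    simp only [map_sub, map_neg, map_add, map_smul, smul_eq_mul]
    ring
  have hT1 : LinearMap.fst ℝ E F ∘ₗ (curvatureEnd G z v w : E × F →ₗ[ℝ] E × F) ∘ₗ
      LinearMap.inl ℝ E F =
      (l : E →ₗ[ℝ] ℝ).smulRight (-(p' • (l v.1 • w.1 + l w.1 • v.1 - g v.1 w.1 • d)) -
        (r' * b) • d + (p' * l v.1) • w.1 - p • X - (p ^ 2 * l v.1) • w.1 -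
        (2 * p ^ 2 * l w.1) • v.1 + (p ^ 2 * g v.1 w.1) • d + (r * q * b) • d) +
      (g w.1 : E →ₗ[ℝ] ℝ).smulRight (-(p' * l v.1) • d + (p ^ 2 * l d) • v.1) +
      (g v.1 : E →ₗ[ℝ] ℝ).smulRight ((p ^ 2 * l w.1) • d) +
      (g X : E →ₗ[ℝ] ℝ).smulRight (p • d) +
      (p' * l v.1 * l w.1 - p * l X - p ^ 2 * l v.1 * l w.1) • LinearMap.id := by
    ext1 u
    simp only [LinearMap.comp_apply, LinearMap.inl_apply, LinearMap.fst_apply,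
      ContinuousLinearMap.coe_coe, curvatureEnd_apply, hdC, hC, warpedChristoffel, map_zero,
      zero_apply, mul_zero, zero_smul, add_zero, zero_add, sub_zero,
      smul_zero, Prod.fst_add, Prod.fst_sub, ← hb, ← hX, LinearMap.add_apply,
      LinearMap.smulRight_apply, LinearMap.smul_apply, LinearMap.id_apply, hgs u]
    simp only [map_add, map_sub, map_neg, map_smul, smul_eq_mul, hgd, ← hb, hgs v.1 u]
    module
  have hT2 : LinearMap.snd ℝ E F ∘ₗ (curvatureEnd G z v w : E × F →ₗ[ℝ] E × F) ∘ₗ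
      LinearMap.inr ℝ E F =
      (curvatureEnd B z.2 v.2 w.2 : F →ₗ[ℝ] F) +
      (-(q' * l v.1 * l w.1) + q * l X - q ^ 2 * l v.1 * l w.1) • LinearMap.id +
      (B z.2 w.2 : F →ₗ[ℝ] ℝ).smulRight ((q * r * l d) • v.2) := by
    ext1 u
    simp only [LinearMap.comp_apply, LinearMap.inr_apply, LinearMap.snd_apply,
      ContinuousLinearMap.coe_coe, curvatureEnd_apply, hdC, hC, warpedChristoffel, map_zero,
      zero_apply, mul_zero, zero_smul, add_zero, zero_add, sub_zero,
      smul_zero, Prod.snd_add, Prod.snd_sub, ← hb, ← hX, LinearMap.add_apply,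
      LinearMap.smulRight_apply, LinearMap.smul_apply, LinearMap.id_apply]
    simp only [map_add, map_neg, map_smul, smul_eq_mul, christoffel_symm hB hBs v.2 u,
      hBs z.2 u w.2, neg_zero, zero_sub]
    module
  rw [localRicci, trace_prod_eq, hT1, hT2, localRicci]
  simp only [map_add, map_smul, LinearMap.trace_smulRight, LinearMap.trace_id,
    ContinuousLinearMap.coe_coe, map_sub, map_neg, smul_eq_mul, hgd, hlX, hBs z.2 w.2 v.2, ← hb,
    hgs w.1 v.1]
  ring

theorem hasDerivAt_logDeriv {φ : ℝ → ℝ} {t : ℝ} (hφ : ContDiffAt ℝ 2 φ t) (h0 : φ t ≠ 0) :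
    HasDerivAt (logDeriv φ) (deriv (logDeriv φ) t) t := by
  have h1 : DifferentiableAt ℝ (deriv φ) t :=
    (hφ.derivWithin (m := 1) (by norm_num)).differentiableAt (by norm_num)
  exact (h1.div (hφ.differentiableAt (by norm_num)) h0).hasDerivAt

/-- The Ricci tensor of `φ(λ)⁻² g + f(λ)² B`. -/
theorem localRicci_warpedLocal [FiniteDimensional ℝ E] [FiniteDimensional ℝ F] {φ f : ℝ → ℝ} {d : E}
    (hφ : ContDiffAt ℝ 2 φ (l z.1)) (hf : ContDiffAt ℝ 2 f (l z.1)) (hφ0 : φ (l z.1) ≠ 0)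
    (hf0 : f (l z.1) ≠ 0) (hB : ContDiffAt ℝ 2 B z.2)
    (hBn : ∀ᶠ y in 𝓝 z.2, ∀ u, (∀ v, B y u v = 0) → u = 0) (hBs : ∀ y u v, B y u v = B y v u)
    (hg : ∀ u, (∀ v, g u v = 0) → u = 0) (hgs : ∀ u v, g u v = g v u) (hd : ∀ v, g d v = l v)
    (v w : E × F) :
    localRicci (warpedLocal g l φ f B) z v w =
      ((Module.finrank ℝ E - 2 : ℝ) * (deriv (logDeriv φ) (l z.1) + logDeriv φ (l z.1) ^ 2) -
        Module.finrank ℝ F * (deriv (logDeriv f) (l z.1) + logDeriv f (l z.1) ^ 2) -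
        2 * Module.finrank ℝ F * logDeriv φ (l z.1) * logDeriv f (l z.1)) * l v.1 * l w.1 +
      l d * (deriv (logDeriv φ) (l z.1) - (Module.finrank ℝ E - 2) * logDeriv φ (l z.1) ^ 2 +
        Module.finrank ℝ F * logDeriv φ (l z.1) * logDeriv f (l z.1)) * g v.1 w.1 -
      l d * (f (l z.1) ^ 2 * φ (l z.1) ^ 2) *
        (deriv (logDeriv f) (l z.1) + Module.finrank ℝ F * logDeriv f (l z.1) ^ 2 -
        (Module.finrank ℝ E - 2) * logDeriv φ (l z.1) * logDeriv f (l z.1)) * B z.2 v.2 w.2 +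
      localRicci B z.2 v.2 w.2 := by
  have hG : ContDiffAt ℝ 2 (warpedLocal g l φ f B) z := contDiffAt_warpedLocal hφ hf hφ0 hB
  have hl : Tendsto (fun y : E × F => l y.1) (𝓝 z) (𝓝 (l z.1)) :=
    (l.continuous.comp continuous_fst).continuousAt
  have hev : ∀ᶠ t in 𝓝 (l z.1), (ContDiffAt ℝ 2 φ t ∧ ContDiffAt ℝ 2 f t) ∧ φ t ≠ 0 ∧ f t ≠ 0 :=
    ((hφ.eventually (by norm_num)).and (hf.eventually (by norm_num))).and
      ((hφ.continuousAt.eventually_ne hφ0).and (hf.continuousAt.eventually_ne hf0))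
  have hp := hasDerivAt_logDeriv hφ hφ0
  have hq := hasDerivAt_logDeriv hf hf0
  have hφ1 := (hφ.differentiableAt (by norm_num)).hasDerivAt
  have hf1 := (hf.differentiableAt (by norm_num)).hasDerivAt
  -- The function `r = f f' φ²` is written as `q f² φ²`, so that its derivative involves second
  -- derivatives only through `q'`.
  have hr := (hq.mul ((hf1.pow 2).mul (hφ1.pow 2)))
  rw [localRicci_of_christoffel_eq (g := g) (l := l) (B := B) (d := d) hp hq hr
    (hB.differentiableAt (by norm_num)) (differentiableAt_christoffel hB
      (isInvertible_of_separatingLeft _ hBn.self_of_nhds))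
    (differentiableAt_christoffel hG (isInvertible_warpedLocal hφ0 hf0 hg hBn.self_of_nhds))
    ?_ hgs hd hBs]
  · simp only [Pi.mul_apply, Pi.pow_apply]
    have e1 : deriv φ (l z.1) = logDeriv φ (l z.1) * φ (l z.1) := by
      rw [logDeriv_apply, div_mul_cancel₀ _ hφ0]
    have e2 : deriv f (l z.1) = logDeriv f (l z.1) * f (l z.1) := by
      rw [logDeriv_apply, div_mul_cancel₀ _ hf0]
    rw [e1, e2]
    push_cast
    ring
  -- The connection formula is needed on a whole neighbourhood, since the curvature differentiates
  -- it.
  · filter_upwards [hl.eventually hev, hG.eventually (by norm_num),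
      continuous_snd.continuousAt.eventually hBn, continuous_snd.continuousAt.eventually
      (hB.eventually (by norm_num))] with y hy hGy hBny hBy v w
    obtain ⟨⟨h1, h2⟩, h3, h4⟩ := hy
    rw [christoffel_warpedLocal (h1.differentiableAt (by norm_num)).hasDerivAt
      (h2.differentiableAt (by norm_num)).hasDerivAt h3 h4 (hBy.differentiableAt (by norm_num))
      (hGy.differentiableAt (by norm_num)) hg hd hBny]
    congr 1
    simp only [Pi.mul_apply, Pi.pow_apply, logDeriv_apply]
    field_simp

end WarpedRicci

end SemiRiem

/-! ### The ODE system for `φ` and `f`, and its solutions. -/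

namespace SemiRiem

/-- The equations on `φ` and `f` expressing that `φ(ξ)⁻² g + f(ξ)² g_F` is Ricci-flat. -/
structure RicciFlatODE (n m : ℕ) (φ f : ℝ → ℝ) (t : ℝ) : Prop where
  mixed : ((n : ℝ) - 2) * (deriv (logDeriv φ) t + logDeriv φ t ^ 2) -
    m * (deriv (logDeriv f) t + logDeriv f t ^ 2) - 2 * m * logDeriv φ t * logDeriv f t = 0
  base : deriv (logDeriv φ) t - ((n : ℝ) - 2) * logDeriv φ t ^ 2 +
    m * logDeriv φ t * logDeriv f t = 0
  fiber : deriv (logDeriv f) t + m * logDeriv f t ^ 2 -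
    ((n : ℝ) - 2) * logDeriv φ t * logDeriv f t = 0

variable {n m : ℕ}

theorem betaC_sq (hn : 3 ≤ n) : ((n : ℝ) - 1) * betaC n m ^ 2 = m * (m + n - 2) := by
  have h3 : (3 : ℝ) ≤ n := by exact_mod_cast hn
  have hm : (0 : ℝ) ≤ m := m.cast_nonneg
  have h : 0 ≤ (m : ℝ) * ((n : ℝ) - 1) * ((m : ℝ) + (n : ℝ) - 2) :=
    mul_nonneg (mul_nonneg hm (by linarith)) (by linarith)
  have h1 : (n : ℝ) - 1 ≠ 0 := by linarith
  rw [betaC, div_pow, Real.sq_sqrt h]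
  field_simp

theorem betaC_pos (hn : 3 ≤ n) (hm : 2 ≤ m) : 0 < betaC n m := by
  have h3 : (3 : ℝ) ≤ n := by exact_mod_cast hn
  have h2 : (2 : ℝ) ≤ m := by exact_mod_cast hm
  have : 0 < (m : ℝ) * ((n : ℝ) - 1) * ((m : ℝ) + (n : ℝ) - 2) :=
    mul_pos (mul_pos (by linarith) (by linarith)) (by linarith)
  exact div_pos (Real.sqrt_pos.2 this) (by linarith)

theorem mul_alphaC (hn : 3 ≤ n) (s : ℝ) : ((n : ℝ) - 2) * alphaC n m s = m + s * betaC n m := by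
  have h3 : (3 : ℝ) ≤ n := by exact_mod_cast hn
  have h1 : (n : ℝ) - 2 ≠ 0 := by linarith
  rw [alphaC]
  field_simp

/-- The `mixed` equation becomes this quadratic once `p = αq` and the other two equations are
inserted. Multiplied by `n - 2`, it says `((n-2)α - m)² = β²`, which holds because `(n-2)α_± - m =
±β`. -/
theorem alphaC_quadratic (hn : 3 ≤ n) {s : ℝ} (hs : s = 1 ∨ s = -1) :
    ((n : ℝ) - 1) * (((n : ℝ) - 2) * alphaC n m s ^ 2 - 2 * m * alphaC n m s) +
      m * (m - 1) = 0 := by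
  have h3 : (3 : ℝ) ≤ n := by exact_mod_cast hn
  have h1 : (n : ℝ) - 2 ≠ 0 := by linarith
  have hs2 : s ^ 2 = 1 := by rcases hs with rfl | rfl <;> norm_num
  have ha := mul_alphaC (m := m) hn s
  have hb := betaC_sq (m := m) hn
  refine (mul_eq_zero.1 (?_ : ((n : ℝ) - 2) * _ = 0)).resolve_left h1
  calc _ = ((n : ℝ) - 1) * ((((n : ℝ) - 2) * alphaC n m s) ^ 2 -
        2 * m * (((n : ℝ) - 2) * alphaC n m s)) + (n - 2) * (m * (m - 1)) := by ring
    _ = ((n : ℝ) - 1) * betaC n m ^ 2 * s ^ 2 - (n - 1) * m ^ 2 + (n - 2) * (m * (m - 1)) := by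
      rw [ha]; ring
    _ = 0 := by rw [hs2, hb]; ring

/-- The constant term `m(m-1)` of the quadratic is nonzero for `m ≥ 2`. -/
theorem alphaC_ne_zero (hn : 3 ≤ n) (hm : 2 ≤ m) {s : ℝ} (hs : s = 1 ∨ s = -1) :
    alphaC n m s ≠ 0 := by
  intro h
  have h2 : (2 : ℝ) ≤ m := by exact_mod_cast hm
  have := alphaC_quadratic (m := m) hn hs
  rw [h] at this
  nlinarith

theorem exists_sign_of_quadratic (hn : 3 ≤ n) {α : ℝ}
    (h : ((n : ℝ) - 1) * (((n : ℝ) - 2) * α ^ 2 - 2 * m * α) + m * (m - 1) = 0) :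
    ∃ s : ℝ, (s = 1 ∨ s = -1) ∧ α = alphaC n m s := by
  have h3 : (3 : ℝ) ≤ n := by exact_mod_cast hn
  have h1 : (n : ℝ) - 2 ≠ 0 := by linarith
  have h2 : (n : ℝ) - 1 ≠ 0 := by linarith
  have hb := betaC_sq (m := m) hn
  have key : ((n : ℝ) - 1) * ((((n : ℝ) - 2) * α - m - betaC n m) *
      (((n : ℝ) - 2) * α - m + betaC n m)) = 0 := by
    linear_combination ((n : ℝ) - 2) * h - hb
  rcases mul_eq_zero.1 ((mul_eq_zero.1 key).resolve_left h2) with h4 | h4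
  · exact ⟨1, Or.inl rfl, by rw [alphaC, eq_div_iff h1]; linarith⟩
  · exact ⟨-1, Or.inr rfl, by rw [alphaC, eq_div_iff h1]; linarith⟩

theorem hasDerivAt_solBase (s k₁ k₂ t : ℝ) :
    HasDerivAt (solBase n m s k₁ k₂) (-s * betaC n m * k₁) t := by
  have := (((hasDerivAt_id t).const_mul k₁).add_const k₂).const_mul (-s * betaC n m)
  convert! this using 1
  ring

theorem solPhi_eq (s k k₁ k₂ t : ℝ) (h : 0 ≤ solBase n m s k₁ k₂ t) :
    solPhi n m s k k₁ k₂ t = k * solF n m s k₁ k₂ t ^ alphaC n m s := by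
  rw [solPhi, solF, ← Real.rpow_mul h]
  congr 2
  ring

theorem logDeriv_const_mul_rpow {u : ℝ → ℝ} {u' c e t : ℝ} (hu : HasDerivAt u u' t) (h0 : 0 < u t)
    (hc : c ≠ 0) : logDeriv (fun x => c * u x ^ e) t = e * u' / u t := by
  have h1 := (hu.rpow_const (p := e) (Or.inl h0.ne')).const_mul c
  rw [logDeriv_apply, h1.deriv, Real.rpow_sub_one h0.ne']
  have := (Real.rpow_pos_of_pos h0 e).ne'
  field_simp

theorem logDeriv_solPhi (hn : 3 ≤ n) (hm : 2 ≤ m) {s k k₁ k₂ t : ℝ} (hs : s = 1 ∨ s = -1)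
    (hk : k ≠ 0) (h : 0 < solBase n m s k₁ k₂ t) :
    logDeriv (solPhi n m s k k₁ k₂) t = alphaC n m s * k₁ / solBase n m s k₁ k₂ t := by
  have hs2 : s ^ 2 = 1 := by rcases hs with rfl | rfl <;> norm_num
  have hb := (betaC_pos hn hm).ne'
  refine (logDeriv_const_mul_rpow (hasDerivAt_solBase s k₁ k₂ t) h hk).trans ?_
  field_simp
  linear_combination alphaC n m s * k₁ * hs2

theorem logDeriv_solF (hn : 3 ≤ n) (hm : 2 ≤ m) {s k₁ k₂ t : ℝ} (hs : s = 1 ∨ s = -1)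
    (h : 0 < solBase n m s k₁ k₂ t) :
    logDeriv (solF n m s k₁ k₂) t = k₁ / solBase n m s k₁ k₂ t := by
  have hs2 : s ^ 2 = 1 := by rcases hs with rfl | rfl <;> norm_num
  have hb := (betaC_pos hn hm).ne'
  have h1 := logDeriv_const_mul_rpow (c := 1) (e := -s * (1 / betaC n m))
    (hasDerivAt_solBase s k₁ k₂ t) h one_ne_zero
  simp only [one_mul] at h1
  refine h1.trans ?_
  field_simp
  linear_combination k₁ * hs2

/-- The explicit functions solve the equations. -/
theorem ricciFlatODE_of_eq_sol (hn : 3 ≤ n) (hm : 2 ≤ m) {J : Set ℝ} (hJ : IsOpen J)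
    {φ f : ℝ → ℝ} {s k k₁ k₂ : ℝ} (hs : s = 1 ∨ s = -1) (hk : k ≠ 0)
    (h : ∀ t ∈ J, 0 < solBase n m s k₁ k₂ t ∧ φ t = solPhi n m s k k₁ k₂ t ∧
      f t = solF n m s k₁ k₂ t) {t : ℝ} (ht : t ∈ J) : RicciFlatODE n m φ f t := by
  have hs2 : s ^ 2 = 1 := by rcases hs with rfl | rfl <;> norm_num
  have hφ : ∀ x ∈ J, logDeriv φ x = alphaC n m s * k₁ / solBase n m s k₁ k₂ x := by
    intro x hx
    have : φ =ᶠ[𝓝 x] solPhi n m s k k₁ k₂ := by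
      filter_upwards [hJ.mem_nhds hx] with y hy using (h y hy).2.1
    rw [← logDeriv_solPhi hn hm hs hk (h x hx).1, logDeriv_apply, logDeriv_apply, this.deriv_eq,
      this.eq_of_nhds]
  have hf : ∀ x ∈ J, logDeriv f x = k₁ / solBase n m s k₁ k₂ x := by
    intro x hx
    have : f =ᶠ[𝓝 x] solF n m s k₁ k₂ := by
      filter_upwards [hJ.mem_nhds hx] with y hy using (h y hy).2.2
    rw [← logDeriv_solF hn hm hs (h x hx).1, logDeriv_apply, logDeriv_apply, this.deriv_eq,
      this.eq_of_nhds]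
  have h0 := (h t ht).1
  have hd : ∀ c, HasDerivAt (fun x => c / solBase n m s k₁ k₂ x)
      (c * k₁ * s * betaC n m / solBase n m s k₁ k₂ t ^ 2) t := by
    intro c
    have := (hasDerivAt_const t c).div (hasDerivAt_solBase (n := n) (m := m) s k₁ k₂ t) h0.ne'
    convert! this using 1
    ring
  have hφd : deriv (logDeriv φ) t = _ :=
    (EventuallyEq.deriv_eq (by filter_upwards [hJ.mem_nhds ht] with y hy using hφ y hy)).trans
      (hd _).deriv
  have hfd : deriv (logDeriv f) t = _ :=
    (EventuallyEq.deriv_eq (by filter_upwards [hJ.mem_nhds ht] with y hy using hf y hy)).trans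
      (hd _).deriv
  -- Both logarithmic derivatives are constants over the affine function `S`. After clearing `S²`,
  -- each equation is a polynomial consequence of `(n-2)α = m + sβ` and the quadratic for `α`.
  have ha := mul_alphaC (m := m) hn s
  have hq := alphaC_quadratic (m := m) hn hs
  have hS := h0.ne'
  have hφt := hφ t ht
  have hft := hf t ht
  generalize solBase n m s k₁ k₂ t = S at hφt hft hφd hfd hS
  constructor
  · rw [hφd, hfd, hφt, hft]
    field_simp
    linear_combination k₁ ^ 2 * hq - k₁ ^ 2 * (((n : ℝ) - 2) * alphaC n m s - m) * ha
  · rw [hφd, hφt, hft]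
    field_simp
    linear_combination (-k₁ ^ 2 * alphaC n m s) * ha
  · rw [hfd, hφt, hft]
    field_simp
    linear_combination (-k₁ ^ 2) * ha

theorem IsProfile.contDiffAt {J : Set ℝ} {φ f : ℝ → ℝ} (h : IsProfile J φ f) {t : ℝ}
    (ht : t ∈ J) : ContDiffAt ℝ 2 φ t ∧ ContDiffAt ℝ 2 f t :=
  ⟨((h.smooth_φ t ht).contDiffAt (h.isOpen.mem_nhds ht)).of_le ENat.LEInfty.out,
    ((h.smooth_f t ht).contDiffAt (h.isOpen.mem_nhds ht)).of_le ENat.LEInfty.out⟩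

/-- An interval is connected. Every integration of the system below consists in finding a first
integral and applying this. -/
theorem eq_of_hasDerivAt_zero {J : Set ℝ} (hJ : IsOpen J) (hJ' : J.OrdConnected) {u : ℝ → ℝ}
    (h : ∀ t ∈ J, HasDerivAt u 0 t) {x y : ℝ} (hx : x ∈ J) (hy : y ∈ J) : u x = u y :=
  hJ.is_const_of_deriv_eq_zero hJ'.isPreconnected
    (fun t ht => (h t ht).differentiableAt.differentiableWithinAt) (fun t ht => (h t ht).deriv) hx hy

/-- Every solution of the equations is one of the explicit functions. -/
theorem exists_eq_sol_of_ricciFlatODE (hn : 3 ≤ n) (hm : 2 ≤ m) {J : Set ℝ} {φ f : ℝ → ℝ}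
    (hP : IsProfile J φ f) (h : ∀ t ∈ J, RicciFlatODE n m φ f t) :
    ∃ s k k₁ k₂ : ℝ, (s = 1 ∨ s = -1) ∧ k ≠ 0 ∧ k₁ ≠ 0 ∧
      ∀ t ∈ J, 0 < solBase n m s k₁ k₂ t ∧ φ t = solPhi n m s k k₁ k₂ t ∧
        f t = solF n m s k₁ k₂ t := by
  have hφ0 := hP.φ_ne_zero
  have hf0 := hP.f_pos
  set p := logDeriv φ with hpdef
  set q := logDeriv f with hqdef
  have hφ : ∀ t ∈ J, HasDerivAt φ (p t * φ t) t := fun t ht => by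
    rw [hpdef, logDeriv_apply, div_mul_cancel₀ _ (hφ0 t ht)]
    exact ((hP.contDiffAt ht).1.differentiableAt (by norm_num)).hasDerivAt
  have hf : ∀ t ∈ J, HasDerivAt f (q t * f t) t := fun t ht => by
    rw [hqdef, logDeriv_apply, div_mul_cancel₀ _ (hf0 t ht).ne']
    exact ((hP.contDiffAt ht).2.differentiableAt (by norm_num)).hasDerivAt
  have hp : ∀ t ∈ J, HasDerivAt p (p t * (((n : ℝ) - 2) * p t - m * q t)) t := fun t ht => by
    have := hasDerivAt_logDeriv (hP.contDiffAt ht).1 (hφ0 t ht)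
    convert! this using 1
    linear_combination -(h t ht).base
  have hq : ∀ t ∈ J, HasDerivAt q (q t * (((n : ℝ) - 2) * p t - m * q t)) t := fun t ht => by
    have := hasDerivAt_logDeriv (hP.contDiffAt ht).2 (hf0 t ht).ne'
    convert! this using 1
    linear_combination -(h t ht).fiber
  -- If `q` vanished identically, `f` would be constant; the empty interval is excluded by
  -- non-constancy too.
  obtain ⟨t₀, ht₀, hq₀⟩ : ∃ t ∈ J, q t ≠ 0 := by
    by_contra! hcon
    have hconst := fun t ht x hx => eq_of_hasDerivAt_zero hP.isOpen hP.ordConnected (u := f)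
      (fun t ht => by simpa [hcon t ht] using hf t ht) (x := t) (y := x) ht hx
    rcases J.eq_empty_or_nonempty with rfl | ⟨x, hx⟩
    · exact hP.f_nonconst ⟨0, by simp⟩
    · exact hP.f_nonconst ⟨f x, fun t ht => hconst t ht x hx⟩
  -- `f ^ m / φ ^ (n - 2)` is an integrating factor
  have hI : ∀ u : ℝ → ℝ, (∀ t ∈ J, HasDerivAt u (u t * (((n : ℝ) - 2) * p t - m * q t)) t) →
      ∀ t ∈ J, HasDerivAt (fun t => u t * f t ^ m / φ t ^ (n - 2)) 0 t := by
    intro u hu t ht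
    have h1 := ((hu t ht).mul ((hf t ht).pow m)).div ((hφ t ht).pow (n - 2))
      (pow_ne_zero _ (hφ0 t ht))
    -- The power rule produces the natural-number exponents `m - 1` and `n - 2 - 1`; both
    -- subtractions are genuine because `m ≥ 1` and `n ≥ 3`.
    have hm' : f t ^ m = f t ^ (m - 1) * f t := by rw [← pow_succ]; congr 1; omega
    have hn' : φ t ^ (n - 2) = φ t ^ (n - 2 - 1) * φ t := by rw [← pow_succ]; congr 1; omega
    convert! h1 using 1
    simp only [Pi.mul_apply, Pi.pow_apply]
    rw [hm', hn', Nat.cast_sub (by omega : 2 ≤ n)]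
    have := hφ0 t ht
    field_simp
    push_cast
    ring
  have hqI := fun t ht => eq_of_hasDerivAt_zero hP.isOpen hP.ordConnected (hI q hq)
    (x := t) (y := t₀) ht ht₀
  have hpI := fun t ht => eq_of_hasDerivAt_zero hP.isOpen hP.ordConnected (hI p hp)
    (x := t) (y := t₀) ht ht₀
  have hμ : ∀ t ∈ J, f t ^ m / φ t ^ (n - 2) ≠ 0 := fun t ht =>
    div_ne_zero (pow_ne_zero _ (hf0 t ht).ne') (pow_ne_zero _ (hφ0 t ht))
  -- The product of `q` with a nowhere zero factor is constant and nonzero at `t₀`.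
  have hqne : ∀ t ∈ J, q t ≠ 0 := by
    intro t ht h0
    have := hqI t ht
    simp only [h0, zero_mul, zero_div, mul_div_assoc] at this
    exact mul_ne_zero hq₀ (hμ t₀ ht₀) this.symm
  obtain ⟨α, hα⟩ : ∃ α, ∀ t ∈ J, p t = α * q t := by
    refine ⟨p t₀ / q t₀, fun t ht => ?_⟩
    have h1 := hqI t ht
    have h2 := hpI t ht
    simp only [mul_div_assoc] at h1 h2
    refine mul_right_cancel₀ (hμ t ht) ?_
    rw [h2, mul_assoc, h1]
    field_simp
  have hquad : ((n : ℝ) - 1) * (((n : ℝ) - 2) * α ^ 2 - 2 * m * α) + m * (m - 1) = 0 := by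
    have h1 := (h t₀ ht₀).mixed
    have h2 := (hp t₀ ht₀).deriv
    have h3 := (hq t₀ ht₀).deriv
    rw [← hpdef, ← hqdef, h2, h3, hα t₀ ht₀] at h1
    refine (mul_eq_zero.1 (?_ : q t₀ ^ 2 * _ = 0)).resolve_left (pow_ne_zero 2 hq₀)
    linear_combination h1
  obtain ⟨s, hs, rfl⟩ := exists_sign_of_quadratic hn hquad
  have hs2 : s ^ 2 = 1 := by rcases hs with rfl | rfl <;> norm_num
  have hβ := betaC_pos hn hm
  have hma := mul_alphaC (m := m) hn s
  set β := betaC n m with hβdef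
  -- With `p = αq`, the common coefficient is `((n-2)α - m) q = sβ q`.
  have hq' : ∀ t ∈ J, HasDerivAt q (s * β * q t ^ 2) t := fun t ht => by
    convert! hq t ht using 1
    rw [hα t ht]
    linear_combination -q t ^ 2 * hma
  -- The logarithmic derivative of `φ f^(-α)` is `p - αq = 0`; its constant value will be `k`.
  have hk : ∀ t ∈ J, φ t * f t ^ (-alphaC n m s) = φ t₀ * f t₀ ^ (-alphaC n m s) := by
    refine fun t ht => eq_of_hasDerivAt_zero hP.isOpen hP.ordConnected
      (u := fun t => φ t * f t ^ (-alphaC n m s)) (fun t ht => ?_) ht ht₀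
    have := (hφ t ht).mul ((hf t ht).rpow_const (p := -alphaC n m s) (Or.inl (hf0 t ht).ne'))
    convert! this using 1
    rw [Real.rpow_sub_one (hf0 t ht).ne', hα t ht]
    have := hf0 t ht
    field_simp
    ring
  -- Differentiating gives `sβ q² - sβ q²` times a power of `f`; the constant value will be `k₁`.
  have hk₁ : ∀ t ∈ J, q t * f t ^ (-(s * β)) = q t₀ * f t₀ ^ (-(s * β)) := by
    refine fun t ht => eq_of_hasDerivAt_zero hP.isOpen hP.ordConnected
      (u := fun t => q t * f t ^ (-(s * β))) (fun t ht => ?_) ht ht₀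
    have := (hq' t ht).mul ((hf t ht).rpow_const (p := -(s * β)) (Or.inl (hf0 t ht).ne'))
    convert! this using 1
    rw [Real.rpow_sub_one (hf0 t ht).ne']
    have := hf0 t ht
    field_simp
    ring
  have hinv : ∀ t ∈ J, (q t)⁻¹ + s * β * t = (q t₀)⁻¹ + s * β * t₀ := by
    refine fun t ht => eq_of_hasDerivAt_zero hP.isOpen hP.ordConnected
      (u := fun t => (q t)⁻¹ + s * β * t) (fun t ht => ?_) ht ht₀
    have := ((hq' t ht).inv (hqne t ht)).add ((hasDerivAt_id t).const_mul (s * β))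
    convert! this using 1
    have := hqne t ht
    field_simp
    ring
  set k := φ t₀ * f t₀ ^ (-alphaC n m s) with hkdef
  set k₁ := q t₀ * f t₀ ^ (-(s * β)) with hk₁def
  -- The value of `k₂` is forced: by `hinv` and `s² = 1`, it makes `k₁ t + k₂ = -s k₁ / (β q)`. The
  -- bracket `-sβ(k₁ t + k₂)` is then `k₁ / q`, that is, `f^(-sβ)`.
  have hS : ∀ t ∈ J, solBase n m s k₁ (-(k₁ * s / β * ((q t₀)⁻¹ + s * β * t₀))) t =
      f t ^ (-(s * β)) := by
    intro t ht
    rw [← hinv t ht, solBase, ← hβdef, ← mul_right_inj' (hqne t ht), hk₁ t ht]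
    have := hqne t ht
    field_simp
    linear_combination (k₁ + k₁ * t * β * q t * s) * hs2
  have hF : ∀ t ∈ J, solF n m s k₁ (-(k₁ * s / β * ((q t₀)⁻¹ + s * β * t₀))) t = f t := by
    intro t ht
    rw [solF, hS t ht, ← Real.rpow_mul (hf0 t ht).le, ← hβdef]
    -- The exponents multiply to `(-sβ)(-s/β) = s² = 1`.
    convert! Real.rpow_one _ using 2
    field_simp
    linear_combination hs2
  have hpos : ∀ t ∈ J, 0 < solBase n m s k₁ (-(k₁ * s / β * ((q t₀)⁻¹ + s * β * t₀))) t :=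
    fun t ht => by rw [hS t ht]; exact Real.rpow_pos_of_pos (hf0 t ht) _
  refine ⟨s, k, k₁, -(k₁ * s / β * ((q t₀)⁻¹ + s * β * t₀)), hs,
    mul_ne_zero (hφ0 t₀ ht₀) (Real.rpow_pos_of_pos (hf0 t₀ ht₀) _).ne',
    mul_ne_zero hq₀ (Real.rpow_pos_of_pos (hf0 t₀ ht₀) _).ne', fun t ht => ⟨hpos t ht, ?_,
    (hF t ht).symm⟩⟩
  rw [solPhi_eq _ _ _ _ _ (hpos t ht).le, hF t ht, ← hk t ht, mul_assoc,
    ← Real.rpow_add (hf0 t ht), neg_add_cancel, Real.rpow_zero, mul_one]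

/-- Non-constancy follows from a nonzero logarithmic derivative at one point of `J`, which is why
`J` must be nonempty. -/
theorem isProfile_sol (hn : 3 ≤ n) (hm : 2 ≤ m) {J : Set ℝ} (hJ : IsOpen J)
    (hJ' : J.OrdConnected) (hne : J.Nonempty) {s k k₁ k₂ : ℝ} (hs : s = 1 ∨ s = -1) (hk : k ≠ 0)
    (hk₁ : k₁ ≠ 0) (h : ∀ t ∈ J, 0 < solBase n m s k₁ k₂ t) :
    IsProfile J (solPhi n m s k k₁ k₂) (solF n m s k₁ k₂) := by
  have hsm : ∀ e : ℝ, ContDiffOn ℝ ∞ (fun t => solBase n m s k₁ k₂ t ^ e) J := by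
    intro e t ht
    have : ContDiff ℝ ∞ (solBase n m s k₁ k₂) := by unfold solBase; fun_prop
    exact (this.contDiffAt.rpow_const_of_ne (h t ht).ne').contDiffWithinAt
  have hnc : ∀ u : ℝ → ℝ, (∀ t ∈ J, logDeriv u t ≠ 0) → ¬ ∃ c, ∀ t ∈ J, u t = c := by
    rintro u hu ⟨c, hc⟩
    obtain ⟨t, ht⟩ := hne
    have : u =ᶠ[𝓝 t] fun _ => c := by filter_upwards [hJ.mem_nhds ht] with y hy using hc y hy
    exact hu t ht (by rw [logDeriv_apply, this.deriv_eq]; simp)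
  refine ⟨hJ, hJ', contDiffOn_const.mul (hsm _), hsm _, fun t ht => ?_, fun t ht => ?_,
    hnc _ fun t ht => ?_, hnc _ fun t ht => ?_⟩
  · exact mul_ne_zero hk (Real.rpow_pos_of_pos (h t ht) _).ne'
  · exact Real.rpow_pos_of_pos (h t ht) _
  · rw [logDeriv_solPhi hn hm hs hk (h t ht)]
    exact div_ne_zero (mul_ne_zero (alphaC_ne_zero hn hm hs) hk₁) (h t ht).ne'
  · rw [logDeriv_solF hn hm hs (h t ht)]
    exact div_ne_zero hk₁ (h t ht).ne'

end SemiRiem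

namespace SemiRiem

/-! ### Metrics on manifolds and warped products in preferred charts. -/

section Chart

variable {E : Type*} [NormedAddCommGroup E] [NormedSpace ℝ E]
  {M : Type*} [TopologicalSpace M] [ChartedSpace E M]

theorem mdifferentiableAt_extChartAt_symm [IsManifold 𝓘(ℝ, E) ∞ M] {p : M} {y : E}
    (hy : y ∈ (extChartAt 𝓘(ℝ, E) p).target) :
    MDifferentiableAt 𝓘(ℝ, E) 𝓘(ℝ, E) (extChartAt 𝓘(ℝ, E) p).symm y := by
  have : IsManifold 𝓘(ℝ, E) 1 M := .of_le (n := ∞) ENat.LEInfty.out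
  have := mdifferentiableWithinAt_extChartAt_symm hy
  rwa [ModelWithCorners.range_eq_univ, mdifferentiableWithinAt_univ] at this

theorem isInvertible_mfderiv_extChartAt_symm [IsManifold 𝓘(ℝ, E) ∞ M] {p : M} {y : E}
    (hy : y ∈ (extChartAt 𝓘(ℝ, E) p).target) :
    (mfderiv 𝓘(ℝ, E) 𝓘(ℝ, E) (extChartAt 𝓘(ℝ, E) p).symm y).IsInvertible := by
  have : IsManifold 𝓘(ℝ, E) 1 M := .of_le (n := ∞) ENat.LEInfty.out
  have := isInvertible_mfderivWithin_extChartAt_symm hy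
  rwa [ModelWithCorners.range_eq_univ, mfderivWithin_univ] at this

variable {g : BilinField 𝓘(ℝ, E) M}

/-- Symmetry survives pullback by any linear map, so `y` need not lie in the chart target. -/
theorem IsSemiRiemannianMetric.inChart_symm (hg : IsSemiRiemannianMetric g) (p : M) (y u v : E) :
    inChart g p y u v = inChart g p y v u :=
  hg.symm ((extChartAt 𝓘(ℝ, E) p).symm y)
    (mfderiv 𝓘(ℝ, E) 𝓘(ℝ, E) (extChartAt 𝓘(ℝ, E) p).symm y u)
    (mfderiv 𝓘(ℝ, E) 𝓘(ℝ, E) (extChartAt 𝓘(ℝ, E) p).symm y v)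

theorem IsSemiRiemannianMetric.inChart_nondegenerate [IsManifold 𝓘(ℝ, E) ∞ M]
    (hg : IsSemiRiemannianMetric g) (p : M) {y : E} (hy : y ∈ (extChartAt 𝓘(ℝ, E) p).target) (u : E)
    (h : ∀ v, inChart g p y u v = 0) : u = 0 := by
  obtain ⟨e, he⟩ := isInvertible_mfderiv_extChartAt_symm hy
  have hA : ∀ x, e x = mfderiv 𝓘(ℝ, E) 𝓘(ℝ, E) (extChartAt 𝓘(ℝ, E) p).symm y x :=
    fun x => congrArg (fun T => T x) he
  have h0 : e u = 0 := by
    refine hg.nondegenerate _ _ fun v => ?_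
    have h2 : g ((extChartAt 𝓘(ℝ, E) p).symm y) (e u) (e (e.symm v)) = 0 := by
      rw [hA (e.symm v), hA u]
      exact h (e.symm v)
    rwa [e.apply_symm_apply] at h2
  exact e.map_eq_zero_iff.1 h0

variable {E₁ : Type*} [NormedAddCommGroup E₁] [NormedSpace ℝ E₁]

/-- In the preferred charts a warped product metric over a vector space is the warped product of the
expressions of the two metrics. -/
theorem inChart_warped [IsManifold 𝓘(ℝ, E) ∞ M] (gB : BilinField 𝓘(ℝ, E₁) E₁) (f : E₁ → ℝ)
    (p : E₁ × M) {z : E₁ × E} (hz : z.2 ∈ (extChartAt 𝓘(ℝ, E) p.2).target) (u v : E₁ × E) :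
    inChart (warped gB f g) p z u v =
      gB z.1 u.1 v.1 + f z.1 ^ 2 * inChart g p.2 z.2 u.2 v.2 := by
  -- The chart of a vector space is the identity, so the inverse product chart acts on the fiber
  -- coordinate only.
  have hs : ((extChartAt (𝓘(ℝ, E₁).prod 𝓘(ℝ, E)) p).symm : E₁ × E → E₁ × M) =
      Prod.map id (extChartAt 𝓘(ℝ, E) p.2).symm := by
    rw [extChartAt_prod, extChartAt_model_space_eq_id]
    rfl
  have hd : mfderiv 𝓘(ℝ, E₁ × E) (𝓘(ℝ, E₁).prod 𝓘(ℝ, E))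
      (extChartAt (𝓘(ℝ, E₁).prod 𝓘(ℝ, E)) p).symm z =
      (ContinuousLinearMap.id ℝ E₁).prodMap
        (mfderiv 𝓘(ℝ, E) 𝓘(ℝ, E) (extChartAt 𝓘(ℝ, E) p.2).symm z.2) := by
    rw [hs]
    have := HasMFDerivAt.prodMap (p := z) (hasMFDerivAt_id (I := 𝓘(ℝ, E₁)) z.1)
      (mdifferentiableAt_extChartAt_symm hz).hasMFDerivAt
    rw [modelWithCornersSelf_prod, ← chartedSpaceSelf_prod]
    refine this.mfderiv.trans ?_
    rw [mfderiv_id]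
    rfl
  have h0 : inChart (warped gB f g) p z u v =
      warped gB f g ((extChartAt (𝓘(ℝ, E₁).prod 𝓘(ℝ, E)) p).symm z)
        (mfderiv 𝓘(ℝ, E₁ × E) (𝓘(ℝ, E₁).prod 𝓘(ℝ, E))
          (extChartAt (𝓘(ℝ, E₁).prod 𝓘(ℝ, E)) p).symm z u)
        (mfderiv 𝓘(ℝ, E₁ × E) (𝓘(ℝ, E₁).prod 𝓘(ℝ, E))
          (extChartAt (𝓘(ℝ, E₁).prod 𝓘(ℝ, E)) p).symm z v) := rfl
  rw [h0, hd]
  exact warped_apply gB f g _ _ _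

end Chart

end SemiRiem

namespace SemiRiem

/-! ### Linear algebra of the pseudo-Euclidean form and of `ξ`. -/

section PseudoEuclidean

variable {n : ℕ}

/-- The linear form `ξ = ∑ a_i x_i`, as a continuous linear map. -/
noncomputable def xiCLM (a : Fin n → ℝ) : EuclideanSpace ℝ (Fin n) →L[ℝ] ℝ :=
  ∑ i, a i • (EuclideanSpace.proj i : EuclideanSpace ℝ (Fin n) →L[ℝ] ℝ)

theorem xiCLM_apply (a : Fin n → ℝ) (x : EuclideanSpace ℝ (Fin n)) : xiCLM a x = xi a x := by
  simp [xiCLM, xi]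

/-- The vector dual to `ξ` under the pseudo-Euclidean metric. -/
noncomputable def xiDual (ε a : Fin n → ℝ) : EuclideanSpace ℝ (Fin n) :=
  WithLp.toLp 2 fun i => ε i * a i

variable {ε : Fin n → ℝ}

theorem pseudoForm_symm (u v : EuclideanSpace ℝ (Fin n)) :
    pseudoForm ε u v = pseudoForm ε v u := by
  simp only [pseudoForm_apply, mul_comm (u _)]

theorem pseudoForm_single (u : EuclideanSpace ℝ (Fin n)) (i : Fin n) :
    pseudoForm ε u (EuclideanSpace.single i 1) = ε i * u i := by
  simp [pseudoForm_apply]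

theorem pseudoForm_nondegenerate (hε : ∀ i, ε i = 1 ∨ ε i = -1) (u : EuclideanSpace ℝ (Fin n))
    (h : ∀ v, pseudoForm ε u v = 0) : u = 0 := by
  ext i
  have h1 := h (EuclideanSpace.single i 1)
  rw [pseudoForm_single] at h1
  rcases hε i with h2 | h2 <;> simpa [h2] using h1

theorem pseudoForm_xiDual (hε : ∀ i, ε i = 1 ∨ ε i = -1) (a : Fin n → ℝ)
    (v : EuclideanSpace ℝ (Fin n)) : pseudoForm ε (xiDual ε a) v = xiCLM a v := by
  rw [pseudoForm_apply, xiCLM_apply, xi]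
  refine Finset.sum_congr rfl fun i _ => ?_
  rcases hε i with h2 | h2 <;> simp [xiDual, h2]

theorem xi_xiDual (a : Fin n → ℝ) : xi a (xiDual ε a) = ∑ i, ε i * a i ^ 2 := by
  rw [xi]
  refine Finset.sum_congr rfl fun i _ => ?_
  simp only [xiDual]
  ring

theorem exists_ne_zero_ker {E : Type*} [NormedAddCommGroup E] [NormedSpace ℝ E]
    [FiniteDimensional ℝ E] (h : 1 < Module.finrank ℝ E) (l : E →L[ℝ] ℝ) : ∃ v ≠ 0, l v = 0 := by
  have := LinearMap.ker_ne_bot_of_finrank_lt (f := (l : E →ₗ[ℝ] ℝ)) (by simpa using h)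
  obtain ⟨v, hv, hv0⟩ := (Submodule.ne_bot_iff _).1 this
  exact ⟨v, hv0, hv⟩

end PseudoEuclidean

/-! ### Reduction of Ricci-flatness to the ODE system. -/

section Main

variable {n m : ℕ} {ε a : Fin n → ℝ} {F : Type*} [TopologicalSpace F]
  [ChartedSpace (EuclideanSpace ℝ (Fin m)) F] [IsManifold (𝓡 m) ∞ F] {gF : BilinField (𝓡 m) F}

theorem ricci_warpedMetric_eq_localRicci (φ f : ℝ → ℝ) (p : EuclideanSpace ℝ (Fin n) × F)
    (u v : EuclideanSpace ℝ (Fin n) × EuclideanSpace ℝ (Fin m)) :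
    ricci (warpedMetric ε a φ f gF) p u v =
      localRicci (warpedLocal (pseudoForm ε) (xiCLM a) φ f (inChart gF p.2))
        (p.1, extChartAt (𝓡 m) p.2 p.2) u v := by
  have h : inChart (warpedMetric ε a φ f gF) p =ᶠ[𝓝 (p.1, extChartAt (𝓡 m) p.2 p.2)]
      warpedLocal (pseudoForm ε) (xiCLM a) φ f (inChart gF p.2) := by
    have ht := (isOpen_extChartAt_target (I := 𝓡 m) p.2).mem_nhds (mem_extChartAt_target p.2)
    filter_upwards [(continuous_snd.tendsto (p.1, extChartAt (𝓡 m) p.2 p.2)).eventually ht]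
      with z hz
    refine ContinuousLinearMap.ext fun u => ContinuousLinearMap.ext fun v => ?_
    rw [warpedLocal_apply, xiCLM_apply]
    exact inChart_warped (baseMetric ε a φ) (fun x => f (xi a x)) p hz u v
  rw [← localRicci_congr h]
  -- The image of `p` under the product chart is definitionally `(p.1, extChartAt (𝓡 m) p.2 p.2)`.
  rfl

/-- The Ricci tensor of the warped product metric at a point of the product. -/
theorem ricci_warpedMetric (hε : ∀ i, ε i = 1 ∨ ε i = -1) (hgF : IsSemiRiemannianMetric gF)
    {J : Set ℝ} {φ f : ℝ → ℝ} (hP : IsProfile J φ f) (p : EuclideanSpace ℝ (Fin n) × F)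
    (hp : xi a p.1 ∈ J) (v w : EuclideanSpace ℝ (Fin n) × EuclideanSpace ℝ (Fin m)) :
    ricci (warpedMetric ε a φ f gF) p v w =
      (((n : ℝ) - 2) * (deriv (logDeriv φ) (xi a p.1) + logDeriv φ (xi a p.1) ^ 2) -
        m * (deriv (logDeriv f) (xi a p.1) + logDeriv f (xi a p.1) ^ 2) -
        2 * m * logDeriv φ (xi a p.1) * logDeriv f (xi a p.1)) * xi a v.1 * xi a w.1 +
      (∑ i, ε i * a i ^ 2) * (deriv (logDeriv φ) (xi a p.1) -
        ((n : ℝ) - 2) * logDeriv φ (xi a p.1) ^ 2 +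
        m * logDeriv φ (xi a p.1) * logDeriv f (xi a p.1)) * pseudoForm ε v.1 w.1 -
      (∑ i, ε i * a i ^ 2) * (f (xi a p.1) ^ 2 * φ (xi a p.1) ^ 2) *
        (deriv (logDeriv f) (xi a p.1) + m * logDeriv f (xi a p.1) ^ 2 -
        ((n : ℝ) - 2) * logDeriv φ (xi a p.1) * logDeriv f (xi a p.1)) *
        inChart gF p.2 (extChartAt (𝓡 m) p.2 p.2) v.2 w.2 +
      localRicci (inChart gF p.2) (extChartAt (𝓡 m) p.2 p.2) v.2 w.2 := by
  have ht := (isOpen_extChartAt_target (I := 𝓡 m) p.2).mem_nhds (mem_extChartAt_target p.2)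
  have hB : ContDiffAt ℝ 2 (inChart gF p.2) (extChartAt (𝓡 m) p.2 p.2) :=
    ((hgF.smooth p.2).contDiffAt ht).of_le ENat.LEInfty.out
  rw [← xiCLM_apply] at hp
  rw [ricci_warpedMetric_eq_localRicci, localRicci_warpedLocal (d := xiDual ε a)
    (B := inChart gF p.2) (z := (p.1, extChartAt (𝓡 m) p.2 p.2))
    (hP.contDiffAt hp).1 (hP.contDiffAt hp).2 (hP.φ_ne_zero _ hp) (hP.f_pos _ hp).ne' hB
    (by filter_upwards [ht] with y hy using hgF.inChart_nondegenerate p.2 hy)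
    (hgF.inChart_symm p.2) (pseudoForm_nondegenerate hε) pseudoForm_symm (pseudoForm_xiDual hε a)]
  simp only [xi_xiDual, xiCLM_apply, finrank_euclideanSpace, Fintype.card_fin]

/-- With the fiber Ricci-flat, test vectors isolate the three coefficients of the Ricci tensor. A
base vector in `ker ξ` isolates that of `g`, the dual vector of `ξ` then that of `ξ ⊗ ξ`, and fiber
vectors that of `g_F`. -/
theorem isRicciFlatOn_warpedMetric_iff (hn : 3 ≤ n) (hm : 2 ≤ m) (hε : ∀ i, ε i = 1 ∨ ε i = -1)
    (ha : ∑ i, ε i * a i ^ 2 ≠ 0) [Nonempty F] (hgF : IsSemiRiemannianMetric gF)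
    (hflat : IsRicciFlatOn gF Set.univ) {J : Set ℝ} {φ f : ℝ → ℝ} (hP : IsProfile J φ f) :
    IsRicciFlatOn (warpedMetric ε a φ f gF) {p | xi a p.1 ∈ J} ↔
      ∀ t ∈ J, RicciFlatODE n m φ f t := by
  have hF : ∀ q u v, localRicci (inChart gF q) (extChartAt (𝓡 m) q q) u v = 0 :=
    fun q u v => hflat q (Set.mem_univ q) u v
  constructor
  · intro h t ht
    obtain ⟨q⟩ := ‹Nonempty F›
    obtain ⟨x, rfl⟩ : ∃ x, xi a x = t := by
      -- On the dual vector `ξ` takes the value `∑ ε_i a_i² ≠ 0`, so a multiple of it reaches any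
      -- `t`.
      refine ⟨(t / ∑ i, ε i * a i ^ 2) • xiDual ε a, ?_⟩
      rw [← xiCLM_apply, map_smul, xiCLM_apply, xi_xiDual, smul_eq_mul, div_mul_cancel₀ _ ha]
    have hR := fun v w : EuclideanSpace ℝ (Fin n) × EuclideanSpace ℝ (Fin m) =>
      (ricci_warpedMetric (a := a) hε hgF hP (x, q) ht v w).symm.trans
      (h (x, q) ht v w)
    simp only [hF, add_zero] at hR
    have hfib : ∃ u v, inChart gF q (extChartAt (𝓡 m) q q) u v ≠ 0 := by
      by_contra! hcon
      have : Nontrivial (EuclideanSpace ℝ (Fin m)) :=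
        Module.nontrivial_of_finrank_pos (R := ℝ) (by simp; omega)
      obtain ⟨u, hu⟩ := exists_ne (0 : EuclideanSpace ℝ (Fin m))
      exact hu (hgF.inChart_nondegenerate q (mem_extChartAt_target q) u (hcon u))
    generalize inChart gF q (extChartAt (𝓡 m) q q) = b at hR hfib
    -- As `n ≥ 2`, `ker ξ` contains a nonzero vector, and nondegeneracy pairs it nontrivially with
    -- some `v`.
    have hbase : ∃ u v, xi a u = 0 ∧ pseudoForm ε u v ≠ 0 := by
      obtain ⟨u, hu, hu0⟩ := exists_ne_zero_ker (by simp; omega) (xiCLM a)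
      by_contra! hcon
      exact hu (pseudoForm_nondegenerate hε u fun v => hcon u v (by rw [← xiCLM_apply, hu0]))
    have hb : deriv (logDeriv φ) (xi a x) - ((n : ℝ) - 2) * logDeriv φ (xi a x) ^ 2 +
        m * logDeriv φ (xi a x) * logDeriv f (xi a x) = 0 := by
      obtain ⟨u, v, h1, h2⟩ := hbase
      have := hR (u, 0) (v, 0)
      simpa [h1, h2, ha] using this
    refine ⟨?_, hb, ?_⟩
    · have := hR (xiDual ε a, 0) (xiDual ε a, 0)
      rw [hb, xi_xiDual] at this
      simpa [ha] using this
    · obtain ⟨u, v, h1⟩ := hfib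
      have := hR (0, u) (0, v)
      have h0 : xi a 0 = 0 := by rw [← xiCLM_apply, map_zero]
      simpa [h0, h1, ha, hP.φ_ne_zero _ ht, (hP.f_pos _ ht).ne'] using this
  · intro h p hp u v
    refine (ricci_warpedMetric hε hgF hP p hp u v).trans ?_
    obtain ⟨h1, h2, h3⟩ := h _ hp
    rw [h1, h2, h3, hF]
    simp only [zero_mul, mul_zero, add_zero, sub_zero]

end Main

theorem solBase_pos_of_lt {n m : ℕ} (hn : 3 ≤ n) (hm : 2 ≤ m) {k₁ k₂ t : ℝ} (hk₁ : 0 < k₁)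
    (ht : t < -k₂ / k₁) : 0 < solBase n m 1 k₁ k₂ t := by
  have hb := betaC_pos hn hm
  rw [lt_div_iff₀ hk₁] at ht
  have := mul_pos hb (by linarith : 0 < -(k₁ * t + k₂))
  rw [solBase]
  linarith

theorem solBase_pos_of_gt {n m : ℕ} (hn : 3 ≤ n) (hm : 2 ≤ m) {k₁ k₂ t : ℝ} (hk₁ : 0 < k₁)
    (ht : -k₂ / k₁ < t) : 0 < solBase n m (-1) k₁ k₂ t := by
  have hb := betaC_pos hn hm
  rw [div_lt_iff₀ hk₁] at ht
  have := mul_pos hb (by linarith : 0 < k₁ * t + k₂)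
  rw [solBase]
  linarith

end SemiRiem

theorem theorem1p4 (n m : ℕ) (hn : 3 ≤ n) (hm : 2 ≤ m)
    (ε : Fin n → ℝ) (hε : ∀ i, ε i = 1 ∨ ε i = -1)
    (a : Fin n → ℝ) (ha : ∑ i, ε i * a i ^ 2 ≠ 0)
    {F : Type*} [TopologicalSpace F] [ChartedSpace (EuclideanSpace ℝ (Fin m)) F]
    [IsManifold (𝓡 m) ∞ F] [Nonempty F]
    (gF : BilinField (𝓡 m) F) (hgF : IsSemiRiemannianMetric gF)
    (hflat : IsRicciFlatOn gF Set.univ) :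
    (∀ (J : Set ℝ) (φ f : ℝ → ℝ), IsProfile J φ f →
      (IsRicciFlatOn (warpedMetric ε a φ f gF) {p | xi a p.1 ∈ J} ↔
        ∃ s k k₁ k₂ : ℝ, (s = 1 ∨ s = -1) ∧ k ≠ 0 ∧ k₁ ≠ 0 ∧
          ∀ t ∈ J, 0 < solBase n m s k₁ k₂ t ∧
            φ t = solPhi n m s k k₁ k₂ t ∧ f t = solF n m s k₁ k₂ t)) ∧
    (∀ k k₁ k₂ : ℝ, 0 < k → 0 < k₁ →
      (IsProfile (Set.Iio (-k₂ / k₁)) (solPhi n m 1 k k₁ k₂) (solF n m 1 k₁ k₂) ∧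
        IsRicciFlatOn (warpedMetric ε a (solPhi n m 1 k k₁ k₂) (solF n m 1 k₁ k₂) gF)
          {p | xi a p.1 < -k₂ / k₁}) ∧
      (IsProfile (Set.Ioi (-k₂ / k₁)) (solPhi n m (-1) k k₁ k₂) (solF n m (-1) k₁ k₂) ∧
        IsRicciFlatOn (warpedMetric ε a (solPhi n m (-1) k k₁ k₂) (solF n m (-1) k₁ k₂) gF)
          {p | -k₂ / k₁ < xi a p.1})) := by
  -- Part (1) is isolated because part (2) follows from its backward direction.
  have key : ∀ (J : Set ℝ) (φ f : ℝ → ℝ), IsProfile J φ f →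
      (IsRicciFlatOn (warpedMetric ε a φ f gF) {p | xi a p.1 ∈ J} ↔
        ∃ s k k₁ k₂ : ℝ, (s = 1 ∨ s = -1) ∧ k ≠ 0 ∧ k₁ ≠ 0 ∧
          ∀ t ∈ J, 0 < solBase n m s k₁ k₂ t ∧
            φ t = solPhi n m s k k₁ k₂ t ∧ f t = solF n m s k₁ k₂ t) := by
    intro J φ f hP
    rw [isRicciFlatOn_warpedMetric_iff hn hm hε ha hgF hflat hP]
    exact ⟨exists_eq_sol_of_ricciFlatODE hn hm hP, fun ⟨s, k, k₁, k₂, hs, hk, _, h⟩ t ht =>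
      ricciFlatODE_of_eq_sol hn hm hP.isOpen hs hk h ht⟩
  refine ⟨key, fun k k₁ k₂ hk hk₁ => ?_⟩
  have hlt : ∀ t ∈ Set.Iio (-k₂ / k₁), 0 < solBase n m 1 k₁ k₂ t :=
    fun t ht => solBase_pos_of_lt hn hm hk₁ ht
  have hgt : ∀ t ∈ Set.Ioi (-k₂ / k₁), 0 < solBase n m (-1) k₁ k₂ t :=
    fun t ht => solBase_pos_of_gt hn hm hk₁ ht
  have hPl := isProfile_sol hn hm isOpen_Iio Set.ordConnected_Iio Set.nonempty_Iio (Or.inl rfl)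
    hk.ne' hk₁.ne' hlt
  have hPg := isProfile_sol hn hm isOpen_Ioi Set.ordConnected_Ioi Set.nonempty_Ioi (Or.inr rfl)
    hk.ne' hk₁.ne' hgt
  exact ⟨⟨hPl, (key _ _ _ hPl).2 ⟨1, k, k₁, k₂, Or.inl rfl, hk.ne', hk₁.ne',
      fun t ht => ⟨hlt t ht, rfl, rfl⟩⟩⟩,
    ⟨hPg, (key _ _ _ hPg).2 ⟨-1, k, k₁, k₂, Or.inr rfl, hk.ne', hk₁.ne',
      fun t ht => ⟨hgt t ht, rfl, rfl⟩⟩⟩⟩
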